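/- Let $K$ be a Stonean space, that is, a compact Hausdorff space in which the closure of every open set is open. Let $C(K)$ be the Banach space of continuous complex-valued functions on $K$ with the supremum norm, let $X$ be a complex Banach space, and write $S(\cdot)$ for the unit sphere and $\mathbb{T}=\{\lambda\in\mathbb{C}:|\lambda|=1\}$. Let $\Delta : S(C(K))\to S(X)$ be a surjective isometry (not assumed linear in any sense). Then there is a clopen set $K_1\subseteq K$ such that, for every non-empty clopen set $B\subseteq K$ with characteristic function $\chi_B$ and every $\lambda\in\mathbb{T}$: - if $B\subseteq K_1$, then $\Delta(\lambda\chi_B)=\lambda\,\Delta(\chi_B)$; - if $B\subseteq K\setminus K_1$, then $\Delta(\lambda\chi_B)=\overline{\lambda}\,\Delta(\chi_B)$. In particular, this applies to $B=K_1$ and to $B=K\setminus K_1$ whenever these sets are non-empty. -/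

import Mathlib

/-- The characteristic function of a clopen set `B`, as a continuous complex-valued function. -/
noncomputable def clopenChar {K : Type*} [TopologicalSpace K] (B : Set K) (hB : IsClopen B) :
    C(K, ℂ) where
  toFun := B.indicator (fun _ => (1 : ℂ))
  continuous_toFun := continuous_const.indicator (by simp [hB.frontier_eq])

theorem clopenChar_smul_mem_sphere {K : Type*} [TopologicalSpace K] [CompactSpace K]
    (B : Set K) (hB : IsClopen B) (hne : B.Nonempty) (c : ℂ) (hc : ‖c‖ = 1) :
    c • clopenChar B hB ∈ Metric.sphere (0 : C(K, ℂ)) 1 := by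
  obtain ⟨t, ht⟩ := hne
  rw [mem_sphere_zero_iff_norm]
  apply le_antisymm
  · refine (ContinuousMap.norm_le _ zero_le_one).2 fun x => ?_
    by_cases hx : x ∈ B <;> simp [clopenChar, hx, hc]
  · have h := (c • clopenChar B hB).norm_coe_le_norm t
    simpa [clopenChar, ht, hc] using h

/-- For `B` clopen and non-empty and `|c| = 1`, the element `c χ_B` of the unit sphere of
`C(K, ℂ)`. -/
noncomputable def sphereChar {K : Type*} [TopologicalSpace K] [CompactSpace K]
    (B : Set K) (hB : IsClopen B) (hne : B.Nonempty) (c : ℂ) (hc : ‖c‖ = 1) :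
    Metric.sphere (0 : C(K, ℂ)) 1 :=
  ⟨c • clopenChar B hB, clopenChar_smul_mem_sphere B hB hne c hc⟩

/-! `D` is `Δ` extended by zero; the value at `0` makes the identities below cover empty clopen
sets. As `Δ` is not assumed linear, the points of `K` are recovered metrically. For unit vectors,
`‖f + g‖ = 2` means that some functional in the dual ball is `1` at both, and `D` preserves this
relation. By compactness, for each `x` and unimodular `μ` one functional in the dual ball is `1` at
`D f` for every norm-one `f` with `f x = μ` (`exists_isSupport`). These functionals recover values
at `x` from images under `D`.

Since clopen sets form a base of `K`, it follows that `D` is odd and additive on functions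
unimodular on disjoint clopen sets and zero elsewhere (`map_add`), and that unimodular scalars in
`X` permute the images of such functions with a fixed support (`exists_map_eq_smul`). Let `D j = i D
1`. Comparing distances pointwise, `j` takes only the values `i` and `-i`; put `K₁ = {j = i}`. The
preimage of `λ D χ_B` is determined on `B` by its real inner products with `1` and `j`: it is `λ` on
`K₁` and the conjugate of `λ` off `K₁`. -/

/-- `D` restricts to a surjective isometry between unit spheres, and vanishes at zero. -/
structure IsSphereIso {E F : Type*} [NormedAddCommGroup E] [NormedAddCommGroup F]
    (D : E → F) : Prop where
  norm_map : ∀ f, ‖f‖ = 1 → ‖D f‖ = 1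
  norm_sub : ∀ f g, ‖f‖ = 1 → ‖g‖ = 1 → ‖D f - D g‖ = ‖f - g‖
  surj : ∀ v, ‖v‖ = 1 → ∃ f, ‖f‖ = 1 ∧ D f = v
  map_zero : D 0 = 0

theorem Complex.eq_one_of_re_ge {z : ℂ} (hz : ‖z‖ ≤ 1) (h : 1 ≤ z.re) : z = 1 := by
  have h1 := Complex.re_le_norm z
  have h2 : z.re = 1 := by linarith
  have h3 : ‖z‖ ^ 2 ≤ 1 := by nlinarith [norm_nonneg z]
  rw [← Complex.normSq_eq_norm_sq, Complex.normSq_apply, h2] at h3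
  have h4 : z.im = 0 := by nlinarith [mul_self_nonneg z.im]
  exact Complex.ext (by simp [h2]) (by simp [h4])

theorem Complex.eq_of_norm_add_ge_two {z w : ℂ} (hz : ‖z‖ ≤ 1) (hw : ‖w‖ = 1)
    (h : 2 ≤ ‖z + w‖) : z = w := by
  have h1 : ‖z + w‖ ^ 2 ≥ 4 := by nlinarith
  have h2 := parallelogram_law_with_norm ℝ z w
  have h3 : ‖z - w‖ = 0 := by
    have : ‖z - w‖ ^ 2 ≤ 0 := by rw [hw] at h2; nlinarith [norm_nonneg z]
    nlinarith [norm_nonneg (z - w)]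
  exact sub_eq_zero.1 (norm_eq_zero.1 h3)

theorem IsSphereIso.inj {E F : Type*} [NormedAddCommGroup E] [NormedAddCommGroup F] {D : E → F}
    (hD : IsSphereIso D) {f g : E} (hf : ‖f‖ = 1) (hg : ‖g‖ = 1) (h : D f = D g) : f = g := by
  have := hD.norm_sub f g hf hg
  rw [h, sub_self, norm_zero] at this
  exact sub_eq_zero.1 (norm_eq_zero.1 this.symm)

open Classical in
theorem IsSphereIso.exists_inverse {E F : Type*} [NormedAddCommGroup E] [NormedAddCommGroup F]
    {D : E → F} (hD : IsSphereIso D) :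
    ∃ G : F → E, IsSphereIso G ∧ ∀ f, ‖f‖ = 1 → G (D f) = f := by
  choose G hG1 hG2 using hD.surj
  let H : F → E := fun v => if h : ‖v‖ = 1 then G v h else 0
  have hH : ∀ v (h : ‖v‖ = 1), H v = G v h := fun v h => dif_pos h
  have hl : ∀ f, ‖f‖ = 1 → H (D f) = f := fun f hf => by
    rw [hH _ (hD.norm_map f hf)]
    exact hD.inj (hG1 _ _) hf (hG2 _ _)
  refine ⟨H, ⟨fun v hv => ?_, fun v w hv hw => ?_, fun f hf => ?_, ?_⟩, hl⟩
  · rw [hH v hv]; exact hG1 _ _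
  · rw [hH v hv, hH w hw, ← hD.norm_sub _ _ (hG1 _ _) (hG1 _ _), hG2, hG2]
  · exact ⟨D f, hD.norm_map f hf, hl f hf⟩
  · exact dif_neg (by simp)

/-! ### Common norming functionals -/

section Dual

variable {F : Type*} [NormedAddCommGroup F] [NormedSpace ℂ F]

theorem norm_dual_apply_le_one {Φ : StrongDual ℂ F} (hΦ : ‖Φ‖ ≤ 1) {v : F} (hv : ‖v‖ ≤ 1) :
    ‖Φ v‖ ≤ 1 :=
  (Φ.le_opNorm v).trans (mul_le_one₀ hΦ (norm_nonneg _) hv)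

theorem norm_dual_apply_le {Φ : StrongDual ℂ F} (hΦ : ‖Φ‖ ≤ 1) (v : F) :
    ‖Φ v‖ ≤ ‖v‖ :=
  (Φ.le_opNorm v).trans (mul_le_of_le_one_left (norm_nonneg _) hΦ)

theorem norm_add_eq_two_of_dual {Φ : StrongDual ℂ F} (hΦ : ‖Φ‖ ≤ 1) {u v : F}
    (hu : ‖u‖ ≤ 1) (hv : ‖v‖ ≤ 1) (h1 : Φ u = 1) (h2 : Φ v = 1) : ‖u + v‖ = 2 := by
  apply le_antisymm
  · linarith [norm_add_le u v]
  · have := norm_dual_apply_le hΦ (u + v)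
    rw [map_add, h1, h2] at this
    norm_num at this
    exact this

/-- A norming functional of `u + v` works: its real parts at `u` and `v` are at most `1` and add up
to `2`. -/
theorem exists_dual_of_norm_add_eq_two {u v : F} (hu : ‖u‖ = 1) (hv : ‖v‖ = 1)
    (h : ‖u + v‖ = 2) : ∃ Φ : StrongDual ℂ F, ‖Φ‖ ≤ 1 ∧ Φ u = 1 ∧ Φ v = 1 := by
  obtain ⟨Φ, hΦ, hv2⟩ := exists_dual_vector ℂ (u + v) (by
    intro h0; rw [h0] at h; simp at h)
  refine ⟨Φ, hΦ.le, ?_⟩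
  have hre := congrArg Complex.re hv2
  rw [map_add, h] at hre
  simp at hre
  have a1 := norm_dual_apply_le_one hΦ.le hu.le
  have a2 := norm_dual_apply_le_one hΦ.le hv.le
  have b1 := Complex.re_le_norm (Φ u)
  have b2 := Complex.re_le_norm (Φ v)
  exact ⟨Complex.eq_one_of_re_ge a1 (by linarith), Complex.eq_one_of_re_ge a2 (by linarith)⟩

end Dual

/-! ### Preservation of the relation `‖f + g‖ = 2` -/

namespace IsSphereIso

variable {E F : Type*} [NormedAddCommGroup E] [NormedSpace ℂ E] [NormedAddCommGroup F]
  [NormedSpace ℂ F] {D : E → F}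

/-- The segment from `f` to `g` lies in the sphere. A functional that is `1` at an interior point
`x` of it is `1` at `f` too; this gives `‖D f + D x‖ = 2`, and `x` tends to `g`. -/
theorem norm_add_eq_two (hD : IsSphereIso D) {f g : E} (hf : ‖f‖ = 1) (hg : ‖g‖ = 1)
    (h : ‖f + g‖ = 2) : ‖D f + D g‖ = 2 := by
  obtain ⟨Φ, hΦ, hf1, hg1⟩ := exists_dual_of_norm_add_eq_two hf hg h
  have key : ∀ t : ℝ, 0 < t → t < 1 → 2 - 2 * t ≤ ‖D f + D g‖ := by
    intro t ht0 ht1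
    set x : E := (t : ℂ) • f + ((1 - t : ℝ) : ℂ) • g with hx
    have n1 : ‖(t : ℂ)‖ = t := by simp [abs_of_pos ht0]
    have n2 : ‖((1 - t : ℝ) : ℂ)‖ = 1 - t := by
      rw [Complex.norm_real, Real.norm_of_nonneg (by linarith)]
    have hxn : ‖x‖ = 1 := by
      apply le_antisymm
      · refine (norm_add_le _ _).trans ?_
        rw [norm_smul, norm_smul, n1, n2, hf, hg]; linarith
      · have := norm_dual_apply_le hΦ x
        have h1 : Φ x = 1 := by
          rw [hx, map_add, map_smul, map_smul, hf1, hg1]; simp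
        rwa [h1, norm_one] at this
    -- `D (-x) = -D x` is not known, so the preimage `y` of `-D x` stands in for `-x`.
    obtain ⟨y, hy, hDy⟩ := hD.surj (-D x) (by rw [norm_neg, hD.norm_map x hxn])
    have hxy : ‖x + -y‖ = 2 := by
      rw [← sub_eq_add_neg, ← hD.norm_sub x y hxn hy, hDy, sub_neg_eq_add, ← two_smul ℝ,
        norm_smul, hD.norm_map x hxn]
      norm_num
    obtain ⟨Ψ, hΨ, hΨx, hΨy⟩ := exists_dual_of_norm_add_eq_two hxn (by rwa [norm_neg]) hxy
    have hΨf : Ψ f = 1 := by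
      have a1 := norm_dual_apply_le_one hΨ hf.le
      have a2 := (Complex.re_le_norm _).trans (norm_dual_apply_le_one hΨ hg.le)
      have hre := congrArg Complex.re hΨx
      rw [hx, map_add, map_smul, map_smul, smul_eq_mul, smul_eq_mul, Complex.add_re,
        Complex.re_ofReal_mul, Complex.re_ofReal_mul, Complex.one_re] at hre
      refine Complex.eq_one_of_re_ge a1 ?_
      nlinarith
    have hfy := norm_add_eq_two_of_dual hΨ hf.le (v := -y) (by rw [norm_neg, hy]) hΨf hΨy
    rw [← sub_eq_add_neg, ← hD.norm_sub f y hf hy, hDy, sub_neg_eq_add] at hfy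
    have hxg : ‖D x - D g‖ ≤ 2 * t := by
      rw [hD.norm_sub x g hxn hg]
      have : x - g = (t : ℂ) • (f - g) := by
        rw [hx, smul_sub]; push_cast; rw [sub_smul, one_smul]; abel
      rw [this, norm_smul, n1]
      nlinarith [norm_sub_le f g]
    have := norm_add_le (D f + D g) (D x - D g)
    rw [show D f + D g + (D x - D g) = D f + D x by abel, hfy] at this
    linarith
  apply le_antisymm
  · linarith [norm_add_le (D f) (D g), hD.norm_map f hf, hD.norm_map g hg]
  · by_contra! hlt
    have hnn := norm_nonneg (D f + D g)
    have := key ((2 - ‖D f + D g‖) / 4) (by linarith) (by linarith)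
    linarith

theorem norm_add_eq_two_iff (hD : IsSphereIso D) {f g : E} (hf : ‖f‖ = 1) (hg : ‖g‖ = 1) :
    ‖D f + D g‖ = 2 ↔ ‖f + g‖ = 2 := by
  refine ⟨fun h => ?_, hD.norm_add_eq_two hf hg⟩
  obtain ⟨G, hG, hGD⟩ := hD.exists_inverse
  simpa [hGD f hf, hGD g hg] using
    hG.norm_add_eq_two (hD.norm_map f hf) (hD.norm_map g hg) h

end IsSphereIso

/-! ### Gluing along clopen sets and peak points -/

section ClopenFunctions

variable {K : Type*} [TopologicalSpace K]

theorem clopenChar_of_mem {B : Set K} (hB : IsClopen B) {x : K} (hx : x ∈ B) :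
    clopenChar B hB x = 1 := by simp [clopenChar, hx]

theorem clopenChar_of_notMem {B : Set K} (hB : IsClopen B) {x : K} (hx : x ∉ B) :
    clopenChar B hB x = 0 := by simp [clopenChar, hx]

/-- The function equal to `a` on the clopen set `V` and to `b` off `V`. -/
noncomputable def clopenGlue (V : Set K) (hV : IsClopen V) (a b : C(K, ℂ)) : C(K, ℂ) :=
  clopenChar V hV * a + (1 - clopenChar V hV) * b

theorem clopenGlue_of_mem {V : Set K} (hV : IsClopen V) (a b : C(K, ℂ)) {x : K} (hx : x ∈ V) :
    clopenGlue V hV a b x = a x := by simp [clopenGlue, clopenChar_of_mem hV hx]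

theorem clopenGlue_of_notMem {V : Set K} (hV : IsClopen V) (a b : C(K, ℂ)) {x : K}
    (hx : x ∉ V) : clopenGlue V hV a b x = b x := by
  simp [clopenGlue, clopenChar_of_notMem hV hx]

variable [CompactSpace K]

theorem ContinuousMap.norm_eq_one_of {f : C(K, ℂ)} (h : ∀ x, ‖f x‖ ≤ 1) {x : K}
    (hx : ‖f x‖ = 1) : ‖f‖ = 1 :=
  le_antisymm ((f.norm_le zero_le_one).2 h) (hx ▸ f.norm_coe_le_norm x)

theorem ContinuousMap.exists_norm_apply_eq {f : C(K, ℂ)} (h : ‖f‖ ≠ 0) : ∃ x, ‖f x‖ = ‖f‖ := by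
  have hne : Nonempty K := by
    by_contra hK
    rw [not_nonempty_iff] at hK
    exact h (by rw [Subsingleton.elim f 0, norm_zero])
  obtain ⟨x, -, hx⟩ := isCompact_univ.exists_isMaxOn Set.univ_nonempty
    (f := fun x => ‖f x‖) (by fun_prop)
  exact ⟨x, le_antisymm (f.norm_coe_le_norm x)
    ((f.norm_le (norm_nonneg _)).2 fun y => hx (Set.mem_univ y))⟩

theorem ContinuousMap.norm_apply_le_one {f : C(K, ℂ)} (h : ‖f‖ = 1) (x : K) : ‖f x‖ ≤ 1 :=
  h ▸ f.norm_coe_le_norm x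

theorem ContinuousMap.norm_add_eq_two_of_apply {f g : C(K, ℂ)} (hf : ‖f‖ = 1) (hg : ‖g‖ = 1)
    {x : K} (hx : ‖f x‖ = 1) (h : g x = f x) : ‖f + g‖ = 2 := by
  apply le_antisymm
  · linarith [norm_add_le f g]
  · have := (f + g).norm_coe_le_norm x
    rw [ContinuousMap.add_apply, h, ← two_mul, norm_mul, hx] at this
    simpa using this

/-- If a norm-one `g` is at distance two from `-μ χ_V`, then `g` takes the value `μ` on `V`. -/
theorem ContinuousMap.exists_apply_eq_of_norm_add_eq_two {g h : C(K, ℂ)} (hg : ‖g‖ = 1)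
    {V : Set K} {μ : ℂ} (hμ : ‖μ‖ = 1) (h1 : ∀ x ∈ V, h x = μ) (h0 : ∀ x ∉ V, h x = 0)
    (h2 : ‖g + h‖ = 2) : ∃ x ∈ V, g x = μ := by
  obtain ⟨x, hx⟩ := ContinuousMap.exists_norm_apply_eq (f := g + h) (by rw [h2]; norm_num)
  rw [h2, ContinuousMap.add_apply] at hx
  have hgx := ContinuousMap.norm_apply_le_one hg x
  by_cases hxV : x ∈ V
  · refine ⟨x, hxV, ?_⟩
    rw [h1 x hxV] at hx
    exact Complex.eq_of_norm_add_ge_two hgx hμ hx.ge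
  · rw [h0 x hxV, add_zero] at hx
    linarith

end ClopenFunctions

/-! ### Support functionals -/

/-- A functional in the dual ball taking the value `1` on the image under `D` of the face of all
norm-one `f` with `f x = μ`. -/
structure IsSupport {K : Type*} [TopologicalSpace K] [CompactSpace K] {X : Type*}
    [NormedAddCommGroup X] [NormedSpace ℂ X] (D : C(K, ℂ) → X) (x : K) (μ : ℂ)
    (Φ : StrongDual ℂ X) : Prop where
  norm_le : ‖Φ‖ ≤ 1
  apply_eq_one : ∀ f : C(K, ℂ), ‖f‖ = 1 → f x = μ → Φ (D f) = 1

namespace IsSphereIso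

variable {K : Type*} [TopologicalSpace K] [CompactSpace K]
  {X : Type*} [NormedAddCommGroup X] [NormedSpace ℂ X] {D : C(K, ℂ) → X}

/-- Induction: the average of the images handled so far is a unit vector `D g`. The bump `h` forces
`g` to take the value `μ` on `V`, where the new `f` equals `μ`, so `D g` and `D f` share a
functional. Being `1` at an average forces it to be `1` at each term. -/
theorem exists_dual_finset (hD : IsSphereIso D) {V : Set K} {μ : ℂ} (hμ : ‖μ‖ = 1)
    {h : C(K, ℂ)} (hn : ‖h‖ = 1) (h1 : ∀ x ∈ V, h x = μ) (h0 : ∀ x ∉ V, h x = 0)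
    (s : Finset C(K, ℂ)) (hs : ∀ f ∈ s, ‖f‖ = 1 ∧ ∀ x ∈ V, f x = μ) :
    ∃ Φ : StrongDual ℂ X, ‖Φ‖ ≤ 1 ∧ Φ (D h) = 1 ∧ ∀ f ∈ s, Φ (D f) = 1 := by
  classical
  induction s using Finset.induction_on with
  | empty =>
    obtain ⟨Φ, hΦ, hv⟩ := exists_dual_vector ℂ (D h) (by rw [hD.norm_map h hn]; norm_num)
    exact ⟨Φ, hΦ.le, by rw [hv, hD.norm_map h hn]; simp, by simp⟩
  | insert f s hfs ih =>
    obtain ⟨Φ, hΦ, hΦh, hΦs⟩ := ih fun g hg => hs g (Finset.mem_insert_of_mem hg)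
    obtain ⟨hf, hfV⟩ := hs f (Finset.mem_insert_self f s)
    -- The extra `1` counts `h`.
    set N : ℝ := s.card + 1 with hN
    have hNpos : 0 < N := by positivity
    set v : X := D h + ∑ g ∈ s, D g with hv
    have hΦv : Φ v = (N : ℂ) := by
      rw [hv, map_add, map_sum, hΦh, Finset.sum_congr rfl hΦs]
      simp [hN, add_comm]
    have hvn : ‖v‖ = N := by
      apply le_antisymm
      · have hb : ‖∑ g ∈ s, D g‖ ≤ s.card := by
          refine (norm_sum_le _ _).trans ?_
          rw [Finset.sum_congr rfl fun g hg =>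
            hD.norm_map g (hs g (Finset.mem_insert_of_mem hg)).1]
          simp
        linarith [norm_add_le (D h) (∑ g ∈ s, D g), hD.norm_map h hn]
      · have := norm_dual_apply_le hΦ v
        rwa [hΦv, Complex.norm_real, Real.norm_of_nonneg hNpos.le] at this
    have hN0 : (N : ℂ) ≠ 0 := by exact_mod_cast hNpos.ne'
    obtain ⟨g, hg, hgv⟩ := hD.surj ((N : ℂ)⁻¹ • v) (by
      rw [norm_smul, norm_inv, hvn, Complex.norm_real, Real.norm_of_nonneg hNpos.le,
        inv_mul_cancel₀ hNpos.ne'])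
    have hΦg : Φ (D g) = 1 := by rw [hgv, map_smul, hΦv, smul_eq_mul, inv_mul_cancel₀ hN0]
    have hgh : ‖g + h‖ = 2 := (hD.norm_add_eq_two_iff hg hn).1
      (norm_add_eq_two_of_dual hΦ (hD.norm_map g hg).le (hD.norm_map h hn).le hΦg hΦh)
    obtain ⟨y, hyV, hy⟩ :=
      ContinuousMap.exists_apply_eq_of_norm_add_eq_two hg hμ h1 h0 hgh
    have hgf : ‖g + f‖ = 2 := ContinuousMap.norm_add_eq_two_of_apply hg hf
      (by rw [hy, hμ]) (by rw [hfV y hyV, hy])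
    obtain ⟨Ψ, hΨ, hΨg, hΨf⟩ := exists_dual_of_norm_add_eq_two (hD.norm_map g hg)
      (hD.norm_map f hf) (hD.norm_add_eq_two hg hf hgf)
    have hle : ∀ k : C(K, ℂ), ‖k‖ = 1 → (Ψ (D k)).re ≤ 1 := fun k hk =>
      (Complex.re_le_norm _).trans (norm_dual_apply_le_one hΨ (hD.norm_map k hk).le)
    have hsum : (Ψ (D h)).re + ∑ k ∈ s, (Ψ (D k)).re = N := by
      have : Ψ v = N := by
        rw [hgv, map_smul, smul_eq_mul] at hΨg
        field_simp at hΨg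
        exact hΨg
      rw [hv, map_add, map_sum] at this
      simpa using congrArg Complex.re this
    have hone : ∀ k : C(K, ℂ), ‖k‖ = 1 → 1 ≤ (Ψ (D k)).re → Ψ (D k) = 1 := fun k hk h =>
      Complex.eq_one_of_re_ge (norm_dual_apply_le_one hΨ (hD.norm_map k hk).le) h
    have hs1 : ∀ k ∈ s, ‖k‖ = 1 := fun k hk => (hs k (Finset.mem_insert_of_mem hk)).1
    have hsle : ∑ k ∈ s, (Ψ (D k)).re ≤ ∑ k ∈ s, (1 : ℝ) :=
      Finset.sum_le_sum fun k hk => hle k (hs1 k hk)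
    have hcard : ∑ k ∈ s, (1 : ℝ) = N - 1 := by simp [hN]
    refine ⟨Ψ, hΨ, hone h hn (by linarith), fun k hk => ?_⟩
    rcases Finset.mem_insert.1 hk with rfl | hk
    · exact hΨf
    · refine hone k (hs1 k hk) ?_
      have heq : ∑ k ∈ s, (Ψ (D k)).re = ∑ k ∈ s, (1 : ℝ) :=
        le_antisymm hsle (by linarith [hle h hn])
      exact ((Finset.sum_eq_sum_iff_of_le fun k hk => hle k (hs1 k hk)).1 heq k hk).ge

variable [T2Space K] [TotallyDisconnectedSpace K]

theorem exists_clopen_approx {f : C(K, ℂ)} {x : K} {c : ℂ} (hx : f x = c) {ε : ℝ} (hε : 0 < ε) :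
    ∃ V : Set K, IsClopen V ∧ x ∈ V ∧ ∀ y ∈ V, ‖f y - c‖ < ε := by
  obtain ⟨V, hV, hxV, hsub⟩ := compact_exists_isClopen_in_isOpen
    (U := {y | ‖f y - c‖ < ε}) (isOpen_lt (by fun_prop) continuous_const)
    (show ‖f x - c‖ < ε by simpa [hx] using hε)
  exact ⟨V, hV, hxV, fun y hy => hsub hy⟩

theorem apply_eq_of_forall_norm_add_eq_two {g : C(K, ℂ)} {x : K} {μ : ℂ} (hμ : ‖μ‖ = 1)
    (hg : ‖g‖ = 1) (h : ∀ k : C(K, ℂ), ‖k‖ = 1 → k x = μ → ‖g + k‖ = 2) : g x = μ := by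
  by_contra hne
  obtain ⟨V, hV, hxV, hVε⟩ := exists_clopen_approx (f := g) (x := x) rfl
    (norm_pos_iff.2 (sub_ne_zero.2 hne))
  have hk := mem_sphere_zero_iff_norm.1 (clopenChar_smul_mem_sphere V hV ⟨x, hxV⟩ μ hμ)
  have h1 : ∀ y ∈ V, (μ • clopenChar V hV) y = μ := fun y hy => by
    simp [clopenChar_of_mem hV hy]
  have h0 : ∀ y ∉ V, (μ • clopenChar V hV) y = 0 := fun y hy => by
    simp [clopenChar_of_notMem hV hy]
  obtain ⟨y, hyV, hy⟩ :=
    ContinuousMap.exists_apply_eq_of_norm_add_eq_two hg hμ h1 h0 (h _ hk (h1 x hxV))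
  have := hVε y hyV
  rw [hy, norm_sub_rev] at this
  exact lt_irrefl _ this

/-- A norm-one function with `f x = c` is within `‖μ - c‖ + ε` of a norm-one function that is
constantly `μ` near `x`. -/
theorem exists_norm_one_near {f : C(K, ℂ)} (hf : ‖f‖ = 1) {x : K} {c μ : ℂ} (hμ : ‖μ‖ = 1)
    (hx : f x = c) {ε : ℝ} (hε : 0 < ε) :
    ∃ g : C(K, ℂ), ‖g‖ = 1 ∧ (∃ V : Set K, IsClopen V ∧ x ∈ V ∧ ∀ y ∈ V, g y = μ) ∧
      ‖f - g‖ ≤ ‖c - μ‖ + ε := by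
  obtain ⟨V, hV, hxV, h⟩ := exists_clopen_approx hx hε
  have hg1 : ∀ y ∈ V, clopenGlue V hV (ContinuousMap.const K μ) f y = μ := fun y hy => by
    rw [clopenGlue_of_mem hV _ _ hy, ContinuousMap.const_apply]
  refine ⟨clopenGlue V hV (ContinuousMap.const K μ) f, ?_, ⟨V, hV, hxV, hg1⟩, ?_⟩
  · refine ContinuousMap.norm_eq_one_of (fun y => ?_) (x := x) (by rw [hg1 x hxV, hμ])
    by_cases hy : y ∈ V
    · rw [hg1 y hy, hμ]
    · rw [clopenGlue_of_notMem hV _ _ hy]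
      exact ContinuousMap.norm_apply_le_one hf y
  · refine (ContinuousMap.norm_le _ (by positivity)).2 fun y => ?_
    rw [ContinuousMap.sub_apply]
    by_cases hy : y ∈ V
    · rw [hg1 y hy, ← sub_add_sub_cancel (f y) c μ, add_comm]
      exact (norm_add_le _ _).trans (by linarith [h y hy])
    · rw [clopenGlue_of_notMem hV _ _ hy, sub_self, norm_zero]
      positivity

/-- Banach–Alaoglu. Finitely many functions that are constantly `μ` near `x` are so on a common
clopen `V`, which gives the finite intersection property; functions with only `f x = μ` are limits
of these. -/
theorem exists_isSupport (hD : IsSphereIso D) (x : K) {μ : ℂ} (hμ : ‖μ‖ = 1) :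
    ∃ Φ : StrongDual ℂ X, IsSupport D x μ Φ := by
  classical
  let ι := {f : C(K, ℂ) // ‖f‖ = 1 ∧ ∃ V : Set K, IsClopen V ∧ x ∈ V ∧ ∀ y ∈ V, f y = μ}
  let S : Set (WeakDual ℂ X) :=
    WeakDual.toStrongDual ⁻¹' Metric.closedBall (0 : StrongDual ℂ X) 1
  have hS : IsCompact S := WeakDual.isCompact_closedBall (0 : StrongDual ℂ X) 1
  have hcl : ∀ i : ι, IsClosed {Φ : WeakDual ℂ X | Φ (D i.1) = 1} := fun i =>
    isClosed_eq (WeakDual.eval_continuous (D i.1)) continuous_const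
  obtain ⟨Φ, hΦ, hΦi⟩ := hS.inter_iInter_nonempty _ hcl (by
    intro u
    have hV : ∃ V : Set K, IsClopen V ∧ x ∈ V ∧ ∀ i ∈ u, ∀ y ∈ V, i.1 y = μ := by
      choose W hW hxW hWi using fun i : ι => i.2.2
      refine ⟨⋂ i ∈ u, W i, isClopen_biInter_finset fun i _ => hW i, ?_, ?_⟩
      · exact Set.mem_iInter₂.2 fun i _ => hxW i
      · exact fun i hi y hy => hWi i y (Set.mem_iInter₂.1 hy i hi)
    obtain ⟨V, hV, hxV, hVi⟩ := hV
    have hh1 : ∀ y ∈ V, (μ • clopenChar V hV) y = μ := fun y hy => by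
      simp [clopenChar_of_mem hV hy]
    have hh0 : ∀ y ∉ V, (μ • clopenChar V hV) y = 0 := fun y hy => by
      simp [clopenChar_of_notMem hV hy]
    obtain ⟨Φ, hΦ, -, hΦu⟩ := hD.exists_dual_finset hμ
      (mem_sphere_zero_iff_norm.1 (clopenChar_smul_mem_sphere V hV ⟨x, hxV⟩ μ hμ)) hh1 hh0
      (u.image Subtype.val) (by
        intro f hf
        obtain ⟨i, hi, rfl⟩ := Finset.mem_image.1 hf
        exact ⟨i.2.1, hVi i hi⟩)
    refine ⟨StrongDual.toWeakDual Φ, by simpa [S] using hΦ, Set.mem_iInter₂.2 fun i hi => ?_⟩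
    exact hΦu i.1 (Finset.mem_image_of_mem _ hi))
  have hn : ‖WeakDual.toStrongDual Φ‖ ≤ 1 := by simpa [S] using hΦ
  refine ⟨WeakDual.toStrongDual Φ, hn, fun f hf hfx => ?_⟩
  refine Complex.eq_one_of_re_ge (norm_dual_apply_le_one hn (hD.norm_map f hf).le) ?_
  refine le_of_forall_pos_le_add fun ε hε => ?_
  obtain ⟨g, hg, hgV, hfg⟩ := exists_norm_one_near hf hμ hfx hε
  have hg1 : WeakDual.toStrongDual Φ (D g) = 1 := Set.mem_iInter.1 hΦi ⟨g, hg, hgV⟩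
  have h1 := norm_dual_apply_le hn (D f - D g)
  rw [hD.norm_sub f g hf hg, map_sub, hg1, norm_sub_rev] at h1
  have h2 := (Complex.re_le_norm _).trans h1
  rw [Complex.sub_re, Complex.one_re] at h2
  rw [sub_self, norm_zero] at hfg
  linarith

end IsSphereIso

namespace IsSupport

variable {K : Type*} [TopologicalSpace K] [CompactSpace K] [T2Space K]
  [TotallyDisconnectedSpace K]
  {X : Type*} [NormedAddCommGroup X] [NormedSpace ℂ X] {D : C(K, ℂ) → X}
  {x : K} {μ : ℂ} {Φ : StrongDual ℂ X}

theorem apply_eq_of_eq_one (hΦ : IsSupport D x μ Φ) (hD : IsSphereIso D) (hμ : ‖μ‖ = 1)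
    {g : C(K, ℂ)} (hg : ‖g‖ = 1) (h : Φ (D g) = 1) : g x = μ :=
  IsSphereIso.apply_eq_of_forall_norm_add_eq_two hμ hg fun k hk hkx =>
    (hD.norm_add_eq_two_iff hg hk).1 (norm_add_eq_two_of_dual hΦ.norm_le
      (hD.norm_map g hg).le (hD.norm_map k hk).le h (hΦ.apply_eq_one k hk hkx))

/-- If `D g = -D f`, a support functional at `(x, -μ)` shows that `‖g + k‖ = 2` whenever `k x = μ`;
hence `g x = μ`. -/
theorem apply_eq_neg_one (hΦ : IsSupport D x μ Φ) (hD : IsSphereIso D) (hμ : ‖μ‖ = 1)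
    {f : C(K, ℂ)} (hf : ‖f‖ = 1) (h : f x = -μ) : Φ (D f) = -1 := by
  obtain ⟨g, hg, hgf⟩ := hD.surj (-D f) (by rw [norm_neg, hD.norm_map f hf])
  obtain ⟨Ψ, hΨ⟩ := hD.exists_isSupport x (μ := -μ) (by rwa [norm_neg])
  have hgx : g x = μ := by
    refine IsSphereIso.apply_eq_of_forall_norm_add_eq_two hμ hg fun k hk hkx => ?_
    have hk' : ‖-k‖ = 1 := by rwa [norm_neg]
    rw [← sub_neg_eq_add, ← hD.norm_sub _ _ hg hk', hgf, ← norm_neg, neg_sub, sub_neg_eq_add]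
    exact norm_add_eq_two_of_dual hΨ.norm_le (hD.norm_map _ hk').le (hD.norm_map f hf).le
      (hΨ.apply_eq_one _ hk' (by rw [ContinuousMap.neg_apply, hkx]))
      (hΨ.apply_eq_one _ hf h)
  have := hΦ.apply_eq_one g hg hgx
  rw [hgf, map_neg] at this
  rw [← this, neg_neg]

/-- Up to `ε`, `f` is within `1 - t` and `1 + t` of norm-one functions with values `μ` and `-μ` at
`x`, at whose images `Φ` is `1` and `-1`. -/
theorem re_apply_eq (hΦ : IsSupport D x μ Φ) (hD : IsSphereIso D) (hμ : ‖μ‖ = 1)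
    {f : C(K, ℂ)} (hf : ‖f‖ = 1) {t : ℝ} (h : f x = t * μ) : (Φ (D f)).re = t := by
  have ht : |t| ≤ 1 := by
    have := ContinuousMap.norm_apply_le_one hf x
    rwa [h, norm_mul, hμ, mul_one, Complex.norm_real] at this
  obtain ⟨ht1, ht2⟩ := abs_le.1 ht
  apply le_antisymm
  · refine le_of_forall_pos_le_add fun ε hε => ?_
    obtain ⟨g, hg, ⟨V, -, hxV, hgV⟩, hfg⟩ :=
      IsSphereIso.exists_norm_one_near hf (μ := -μ) (by rwa [norm_neg]) h hε
    have h1 := norm_dual_apply_le hΦ.norm_le (D f - D g)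
    rw [hD.norm_sub f g hf hg, map_sub, hΦ.apply_eq_neg_one hD hμ hg (hgV x hxV)] at h1
    have h2 := (Complex.re_le_norm _).trans (h1.trans hfg)
    have h3 : ‖(t : ℂ) * μ - -μ‖ = t + 1 := by
      rw [show (t : ℂ) * μ - -μ = ((t + 1 : ℝ) : ℂ) * μ by push_cast; ring, norm_mul, hμ, mul_one,
        Complex.norm_real, Real.norm_of_nonneg (by linarith)]
    rw [h3] at h2
    simp at h2
    linarith
  · refine le_of_forall_pos_le_add fun ε hε => ?_
    obtain ⟨g, hg, ⟨V, -, hxV, hgV⟩, hfg⟩ :=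
      IsSphereIso.exists_norm_one_near hf hμ h hε
    have h1 := norm_dual_apply_le hΦ.norm_le (D f - D g)
    rw [hD.norm_sub f g hf hg, map_sub, hΦ.apply_eq_one g hg (hgV x hxV), norm_sub_rev] at h1
    have h2 := (Complex.re_le_norm _).trans (h1.trans hfg)
    have h3 : ‖(t : ℂ) * μ - μ‖ = 1 - t := by
      rw [show (t : ℂ) * μ - μ = -(((1 - t : ℝ) : ℂ) * μ) by push_cast; ring, norm_neg, norm_mul,
        hμ, mul_one, Complex.norm_real, Real.norm_of_nonneg (by linarith)]
    rw [h3] at h2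
    simp at h2
    linarith

end IsSupport

/-! ### Oddness and additivity on functions unimodular on clopen sets -/

/-- `e` takes unimodular values on `U` and vanishes off `U`. -/
structure IsUnimodularOn {K : Type*} [TopologicalSpace K] (U : Set K) (e : C(K, ℂ)) : Prop where
  norm_apply : ∀ x ∈ U, ‖e x‖ = 1
  apply_eq_zero : ∀ x ∉ U, e x = 0

namespace IsUnimodularOn

variable {K : Type*} [TopologicalSpace K] {U V : Set K} {e h : C(K, ℂ)}

theorem neg (he : IsUnimodularOn U e) : IsUnimodularOn U (-e) :=
  ⟨fun x hx => by simpa using he.norm_apply x hx, fun x hx => by simpa using he.apply_eq_zero x hx⟩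

theorem add (he : IsUnimodularOn U e) (hh : IsUnimodularOn V h) (hUV : Disjoint U V) :
    IsUnimodularOn (U ∪ V) (e + h) := by
  refine ⟨fun x hx => ?_, fun x hx => ?_⟩
  · rw [ContinuousMap.add_apply]
    by_cases hxU : x ∈ U
    · rw [hh.apply_eq_zero x (hUV.notMem_of_mem_left hxU), add_zero, he.norm_apply x hxU]
    · rw [he.apply_eq_zero x hxU, zero_add, hh.norm_apply x (hx.resolve_left hxU)]
  · rw [ContinuousMap.add_apply, he.apply_eq_zero x fun h => hx (.inl h),
      hh.apply_eq_zero x fun h => hx (.inr h), add_zero]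

theorem add_compl (he : IsUnimodularOn U e) (hh : IsUnimodularOn V h) (hUV : Uᶜ = V) :
    IsUnimodularOn Set.univ (e + h) := by
  have := he.add hh (hUV ▸ disjoint_compl_right)
  rwa [← hUV, Set.union_compl_self] at this

theorem mul_clopenChar (he : IsUnimodularOn U e) (hV : IsClopen V) :
    IsUnimodularOn (U ∩ V) (clopenChar V hV * e) := by
  refine ⟨fun x hx => ?_, fun x hx => ?_⟩
  · simpa [clopenChar_of_mem hV hx.2] using he.norm_apply x hx.1
  · by_cases hxV : x ∈ V
    · simpa [clopenChar_of_mem hV hxV] using he.apply_eq_zero x fun h => hx ⟨h, hxV⟩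
    · simp [clopenChar_of_notMem hV hxV]

theorem smul_clopenChar (hV : IsClopen V) {c : ℂ} (hc : ‖c‖ = 1) :
    IsUnimodularOn V (c • clopenChar V hV) :=
  ⟨fun x hx => by simpa [clopenChar_of_mem hV hx] using hc,
    fun x hx => by simp [clopenChar_of_notMem hV hx]⟩

theorem clopenChar (hV : IsClopen V) : IsUnimodularOn V (clopenChar V hV) := by
  simpa using smul_clopenChar hV norm_one

theorem eq_zero (he : IsUnimodularOn U e) (hU : U = ∅) : e = 0 := by
  ext x
  exact he.apply_eq_zero x (by simp [hU])

theorem norm_apply_le (he : IsUnimodularOn U e) (x : K) : ‖e x‖ ≤ 1 := by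
  by_cases hx : x ∈ U
  · exact (he.norm_apply x hx).le
  · simp [he.apply_eq_zero x hx]

variable [CompactSpace K]

theorem norm_eq_one (he : IsUnimodularOn U e) (hU : U.Nonempty) : ‖e‖ = 1 := by
  obtain ⟨x, hx⟩ := hU
  exact ContinuousMap.norm_eq_one_of he.norm_apply_le (he.norm_apply x hx)

end IsUnimodularOn

theorem Complex.eq_zero_of_norm_add_sub_le_one {z w : ℂ} (hw : ‖w‖ = 1) (h1 : ‖z + w‖ ≤ 1)
    (h2 : ‖z - w‖ ≤ 1) : z = 0 := by
  have h := parallelogram_law_with_norm ℝ z w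
  rw [hw] at h
  have : ‖z‖ ^ 2 ≤ 0 := by nlinarith [norm_nonneg (z + w), norm_nonneg (z - w)]
  exact norm_eq_zero.1 (by nlinarith [norm_nonneg z])

namespace IsSphereIso

variable {K : Type*} [TopologicalSpace K] [CompactSpace K] [T2Space K]
  [TotallyDisconnectedSpace K]
  {X : Type*} [NormedAddCommGroup X] [NormedSpace ℂ X] {D : C(K, ℂ) → X}
  {U V : Set K} {e h : C(K, ℂ)}

theorem map_neg_of_univ (hD : IsSphereIso D) (he : IsUnimodularOn Set.univ e) :
    D (-e) = -D e := by
  rcases isEmpty_or_nonempty K with hK | hK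
  · rw [he.eq_zero (Set.univ_eq_empty_iff.2 hK), neg_zero, hD.map_zero, neg_zero]
  have hn := he.norm_eq_one Set.univ_nonempty
  obtain ⟨g, hg, hgD⟩ := hD.surj (-D e) (by rw [norm_neg, hD.norm_map e hn])
  rw [← hgD]
  congr 1
  ext x
  have hμ : ‖(-e) x‖ = 1 := he.neg.norm_apply x trivial
  obtain ⟨Φ, hΦ⟩ := hD.exists_isSupport x hμ
  refine (hΦ.apply_eq_of_eq_one hD hμ hg ?_).symm
  rw [hgD, map_neg, hΦ.apply_eq_neg_one hD hμ hn (by simp), neg_neg]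

/-- The midpoint of `D (e + h)` and `D (e - h)` is a unit vector `D c`. Support functionals give `c
= e` on `U`; off `U`, `c` is within `1` of both `h` and `-h`, so it vanishes. -/
theorem map_add_add_map_sub (hD : IsSphereIso D) (he : IsUnimodularOn U e)
    (hh : IsUnimodularOn V h) (hUV : Uᶜ = V) (hU : U.Nonempty) (hV : V.Nonempty) :
    D (e + h) + D (e - h) = (2 : ℂ) • D e := by
  have hun : (Set.univ : Set K).Nonempty := hU.mono (Set.subset_univ _)
  have h1 : ‖e + h‖ = 1 := (he.add_compl hh hUV).norm_eq_one hun
  have h2 : ‖e - h‖ = 1 := by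
    rw [sub_eq_add_neg]; exact (he.add_compl hh.neg hUV).norm_eq_one hun
  have hh1 : ‖h‖ = 1 := hh.norm_eq_one hV
  have hhU : ∀ x ∈ U, h x = 0 := fun x hx => hh.apply_eq_zero x (by rw [← hUV]; exact fun h => h hx)
  set v : X := (2⁻¹ : ℂ) • (D (e + h) + D (e - h)) with hv
  have hΦv : ∀ x ∈ U, ∀ Φ : StrongDual ℂ X, IsSupport D x (e x) Φ → Φ v = 1 := by
    intro x hx Φ hΦ
    rw [hv, map_smul, map_add, hΦ.apply_eq_one _ h1 (by simp [hhU x hx]),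
      hΦ.apply_eq_one _ h2 (by simp [hhU x hx])]
    norm_num
  have hvn : ‖v‖ = 1 := by
    apply le_antisymm
    · rw [hv, norm_smul]
      have := norm_add_le (D (e + h)) (D (e - h))
      rw [hD.norm_map _ h1, hD.norm_map _ h2] at this
      norm_num at this ⊢
      linarith
    · obtain ⟨x, hx⟩ := hU
      obtain ⟨Φ, hΦ⟩ := hD.exists_isSupport x (he.norm_apply x hx)
      have := norm_dual_apply_le hΦ.norm_le v
      rwa [hΦv x hx Φ hΦ, norm_one] at this
  obtain ⟨c, hc, hcv⟩ := hD.surj v hvn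
  have hdiff : ‖D (e + h) - D (e - h)‖ = 2 := by
    rw [hD.norm_sub _ _ h1 h2, show e + h - (e - h) = (2 : ℂ) • h by rw [two_smul]; abel,
      norm_smul, hh1]
    norm_num
  have hc1 : ‖c - (e + h)‖ ≤ 1 := by
    rw [← hD.norm_sub _ _ hc h1, hcv,
      show v - D (e + h) = -((2⁻¹ : ℂ) • (D (e + h) - D (e - h))) by rw [hv]; module,
      norm_neg, norm_smul, hdiff]
    norm_num
  have hc2 : ‖c - (e - h)‖ ≤ 1 := by
    rw [← hD.norm_sub _ _ hc h2, hcv,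
      show v - D (e - h) = (2⁻¹ : ℂ) • (D (e + h) - D (e - h)) by rw [hv]; module,
      norm_smul, hdiff]
    norm_num
  have hce : c = e := by
    ext x
    by_cases hx : x ∈ U
    · obtain ⟨Φ, hΦ⟩ := hD.exists_isSupport x (he.norm_apply x hx)
      exact hΦ.apply_eq_of_eq_one hD (he.norm_apply x hx) hc (by rw [hcv, hΦv x hx Φ hΦ])
    · have a1 := ((c - (e + h)).norm_coe_le_norm x).trans hc1
      have a2 := ((c - (e - h)).norm_coe_le_norm x).trans hc2
      simp only [ContinuousMap.sub_apply, ContinuousMap.add_apply, he.apply_eq_zero x hx,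
        zero_add, zero_sub, sub_neg_eq_add] at a1 a2
      rw [he.apply_eq_zero x hx]
      exact Complex.eq_zero_of_norm_add_sub_le_one (hh.norm_apply x (hUV ▸ hx)) a2 a1
  rw [show D e = v by rw [← hcv, hce], hv, smul_smul]
  norm_num

/-- Exchanging `e` and `h` in `map_add_add_map_sub` and adding cancels `D (e - h)` against `D (h -
e)`. -/
theorem map_add_compl (hD : IsSphereIso D) (he : IsUnimodularOn U e)
    (hh : IsUnimodularOn V h) (hUV : Uᶜ = V) : D (e + h) = D e + D h := by
  rcases U.eq_empty_or_nonempty with hU | hU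
  · rw [he.eq_zero hU, hD.map_zero, zero_add, zero_add]
  rcases V.eq_empty_or_nonempty with hV | hV
  · rw [hh.eq_zero hV, hD.map_zero, add_zero, add_zero]
  have h1 := hD.map_add_add_map_sub he hh hUV hU hV
  have h2 := hD.map_add_add_map_sub hh he (by rw [← hUV, compl_compl]) hV hU
  have h3 : D (h - e) = -D (e - h) := by
    rw [← neg_sub e h, hD.map_neg_of_univ]
    rw [sub_eq_add_neg]
    exact he.add_compl hh.neg hUV
  rw [h3, add_comm h e] at h2
  have h4 : (2 : ℂ) • D (e + h) = (2 : ℂ) • (D e + D h) := by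
    rw [smul_add, ← h1, ← h2, two_smul]; abel
  exact smul_right_injective X two_ne_zero h4

theorem map_neg (hD : IsSphereIso D) (hU : IsClopen U) (he : IsUnimodularOn U e) :
    D (-e) = -D e := by
  rcases U.eq_empty_or_nonempty with hU0 | hUne
  · rw [he.eq_zero hU0, neg_zero, hD.map_zero, neg_zero]
  rcases Uᶜ.eq_empty_or_nonempty with hV | hV
  · rw [Set.compl_empty_iff] at hV
    exact hD.map_neg_of_univ (hV ▸ he)
  have hh := IsUnimodularOn.clopenChar hU.compl
  have h1 := hD.map_add_add_map_sub hh he (compl_compl U) hV hUne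
  rw [sub_eq_add_neg, hD.map_add_compl hh he (compl_compl U),
    hD.map_add_compl hh he.neg (compl_compl U), two_smul] at h1
  have h2 : D (-e) + D e = 0 := by
    rw [← sub_eq_zero] at h1
    rw [← h1]; abel
  exact eq_neg_of_add_eq_zero_left h2

/-- With `k` the characteristic function of the remaining piece, flip signs one piece at a time from
`e + h + k` to its negative. Each intermediate function splits over a set and its complement in two
ways. -/
theorem map_add (hD : IsSphereIso D) (hU : IsClopen U) (hV : IsClopen V)
    (he : IsUnimodularOn U e) (hh : IsUnimodularOn V h) (hUV : Disjoint U V) :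
    D (e + h) = D e + D h := by
  set W := (U ∪ V)ᶜ with hW
  have hWc : IsClopen W := (hU.union hV).compl
  set k := clopenChar W hWc
  have hk : IsUnimodularOn W k := IsUnimodularOn.clopenChar hWc
  have dUW : Disjoint U W := disjoint_compl_right.mono_left Set.subset_union_left
  have dVW : Disjoint V W := disjoint_compl_right.mono_left Set.subset_union_right
  have cV : (U ∪ W)ᶜ = V := by
    ext x
    simp only [hW, Set.mem_compl_iff, Set.mem_union]
    have := (Set.disjoint_left.1 hUV : _) (a := x)
    tauto
  have cU : (V ∪ W)ᶜ = U := by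
    ext x
    simp only [hW, Set.mem_compl_iff, Set.mem_union]
    have := (Set.disjoint_left.1 hUV : _) (a := x)
    tauto
  have a1 := hD.map_add_compl (he.add hh hUV) hk rfl
  have a2 := hD.map_add_compl (he.add hh hUV) hk.neg rfl
  have a3 := hD.map_add_compl (he.add hk.neg dUW) hh cV
  have a4 := hD.map_add_compl (he.add hk.neg dUW) hh.neg cV
  have a5 := hD.map_add_compl (hh.neg.add hk.neg dVW) he cU
  have a6 := hD.map_add_compl (hh.neg.add hk.neg dVW) he.neg cU
  have a7 := hD.map_neg_of_univ ((he.add hh hUV).add_compl hk rfl)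
  rw [hD.map_neg hWc hk] at a2
  rw [hD.map_neg hV hh] at a4
  rw [hD.map_neg hU he] at a6
  rw [show e + -k + h = e + h + -k by abel] at a3
  rw [show -h + -k + e = e + -k + -h by abel] at a5
  rw [show -h + -k + -e = -(e + h + k) by abel] at a6
  have h7 : (2 : ℂ) • D (e + h) = (2 : ℂ) • (D e + D h) := by
    have e1 : D (e + h) = D (e + -k) + D h + D k := by rw [← a3, a2]; abel
    have e2 : D (e + -k) = D (-h + -k) + D e + D h := by rw [← a5, a4]; abel
    have e3 : D (-h + -k) = -(D (e + h) + D k) + D e := by rw [← a1, ← a7, a6]; abel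
    rw [e3] at e2
    rw [e2] at e1
    rw [two_smul]
    nth_rewrite 1 [e1]
    module
  exact smul_right_injective X two_ne_zero h7

end IsSphereIso

/-! ### Scalars in the target and the splitting of `K` -/

theorem Complex.inner_eq_of_norm_le {z w c d : ℂ} (hz : ‖z‖ = 1) (hw : ‖w‖ = 1) (hc : ‖c‖ = 1)
    (hd : ‖d‖ = 1) (h1 : ‖z - w‖ ≤ ‖c - d‖) (h2 : ‖z + w‖ ≤ ‖c + d‖) :
    inner ℝ z w = inner ℝ c d := by
  have a1 := pow_le_pow_left₀ (norm_nonneg _) h1 2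
  have a2 := pow_le_pow_left₀ (norm_nonneg _) h2 2
  rw [norm_sub_sq_real, norm_sub_sq_real, hz, hw, hc, hd] at a1
  rw [norm_add_sq_real, norm_add_sq_real, hz, hw, hc, hd] at a2
  linarith

namespace IsSphereIso

variable {K : Type*} [TopologicalSpace K] [CompactSpace K] [T2Space K]
  [TotallyDisconnectedSpace K]
  {X : Type*} [NormedAddCommGroup X] [NormedSpace ℂ X] {D : C(K, ℂ) → X}
  {B : Set K} {e : C(K, ℂ)}

/-- Support functionals at points off `B` annihilate the images of functions living on `B`. -/
theorem support_apply_eq_zero (hD : IsSphereIso D) (hB : IsClopen B) (he : IsUnimodularOn B e)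
    {x : K} (hx : x ∉ B) {μ : ℂ} (hμ : ‖μ‖ = 1) {Φ : StrongDual ℂ X} (hΦ : IsSupport D x μ Φ) :
    Φ (D e) = 0 := by
  rcases B.eq_empty_or_nonempty with hB0 | hBne
  · rw [he.eq_zero hB0, hD.map_zero, _root_.map_zero]
  have hh := IsUnimodularOn.smul_clopenChar hB.compl hμ
  have h1 : (Φ (D e)).re = 0 := by
    exact hΦ.re_apply_eq hD hμ (he.norm_eq_one hBne) (by simp [he.apply_eq_zero x hx])
  have h2 : Φ (D (μ • clopenChar Bᶜ hB.compl)) = 1 :=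
    hΦ.apply_eq_one _ (hh.norm_eq_one ⟨x, hx⟩) (by simp [clopenChar_of_mem hB.compl hx])
  -- `re_apply_eq` controls only the real part; the bound `‖Φ (D e) + 1‖ ≤ 1` removes the imaginary
  -- part.
  have h3 := norm_dual_apply_le_one hΦ.norm_le
    (hD.norm_map _ ((he.add_compl hh rfl).norm_eq_one ⟨x, trivial⟩)).le
  rw [hD.map_add_compl he hh rfl, _root_.map_add, h2] at h3
  have h4 := Complex.eq_one_of_re_ge h3 (by simp [h1])
  simpa using h4

/-- Multiplication by a unimodular scalar in the target keeps images of functions that are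
unimodular on a clopen set. -/
theorem exists_map_eq_smul (hD : IsSphereIso D) (hB : IsClopen B) (he : IsUnimodularOn B e)
    {c : ℂ} (hc : ‖c‖ = 1) : ∃ g, IsUnimodularOn B g ∧ D g = c • D e := by
  rcases B.eq_empty_or_nonempty with hB0 | hBne
  · exact ⟨e, he, by rw [he.eq_zero hB0, hD.map_zero, smul_zero]⟩
  have key : ∀ {A : Set K} {a : C(K, ℂ)}, IsClopen A → A.Nonempty → IsUnimodularOn A a →
      ∃ g : C(K, ℂ), ‖g‖ = 1 ∧ (∀ x ∉ A, g x = 0) ∧ D g = c • D a := by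
    intro A a hA hAne ha
    obtain ⟨g, hg, hgD⟩ := hD.surj (c • D a) (by
      rw [norm_smul, hc, hD.norm_map a (ha.norm_eq_one hAne), one_mul])
    refine ⟨g, hg, fun x hx => ?_, hgD⟩
    by_contra hne
    have hn : ‖g x‖ ≠ 0 := norm_ne_zero_iff.2 hne
    have hn' : (‖g x‖ : ℂ) ≠ 0 := by exact_mod_cast hn
    have hμ : ‖g x / ‖g x‖‖ = 1 := by
      rw [norm_div, Complex.norm_real, norm_norm, div_self hn]
    obtain ⟨Φ, hΦ⟩ := hD.exists_isSupport x hμ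
    have h1 := hΦ.re_apply_eq hD hμ hg (t := ‖g x‖) (by field_simp)
    rw [hgD, map_smul, hD.support_apply_eq_zero hA ha hx hμ hΦ, smul_zero] at h1
    exact hn h1.symm
  obtain ⟨g, hg, hg0, hgD⟩ := key hB hBne he
  refine ⟨g, ⟨fun y hy => ?_, hg0⟩, hgD⟩
  -- If `‖g‖ < 1` on a clopen `V` around `y`, the part of `e` on `V` yields `k` peaking at some `x ∈
  -- V`; a support functional there forces `g x = k x`, of modulus one.
  by_contra hne
  have hlt : ‖g y‖ < 1 := lt_of_le_of_ne (ContinuousMap.norm_apply_le_one hg y) hne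
  obtain ⟨V, hV, hyV, hsub⟩ := compact_exists_isClopen_in_isOpen
    (U := {z | ‖g z‖ < 1}) (isOpen_lt (by fun_prop) continuous_const) hlt
  have he1 := he.mul_clopenChar hV
  have he2 := he.mul_clopenChar hV.compl
  have hsum : clopenChar V hV * e + clopenChar Vᶜ hV.compl * e = e := by
    ext x
    by_cases hx : x ∈ V
    · simp [clopenChar_of_mem hV hx, clopenChar_of_notMem hV.compl (not_not.2 hx)]
    · simp [clopenChar_of_notMem hV hx, clopenChar_of_mem hV.compl hx]
  have hadd := hD.map_add (hB.inter hV) (hB.inter hV.compl) he1 he2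
    (disjoint_compl_right.mono Set.inter_subset_right Set.inter_subset_right)
  rw [hsum] at hadd
  obtain ⟨k, hk, hk0, hkD⟩ := key (hB.inter hV) ⟨y, hy, hyV⟩ he1
  obtain ⟨x, hx⟩ := ContinuousMap.exists_norm_apply_eq (f := k) (by rw [hk]; norm_num)
  rw [hk] at hx
  have hxV : x ∈ V := by
    by_contra hxV
    rw [hk0 x fun h => hxV h.2, norm_zero] at hx
    exact zero_ne_one hx
  obtain ⟨Φ, hΦ⟩ := hD.exists_isSupport x hx
  have h2 := hD.support_apply_eq_zero (hB.inter hV.compl) he2 (x := x) (fun h => h.2 hxV) hx hΦ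
  have h3 : Φ (D g) = 1 := by
    rw [hgD, hadd, smul_add, _root_.map_add, ← hkD, hΦ.apply_eq_one k hk rfl, map_smul, h2,
      smul_zero, add_zero]
  have h4 := hΦ.apply_eq_of_eq_one hD hx hg h3
  have h5 : ‖g x‖ < 1 := hsub hxV
  rw [h4, hx] at h5
  exact lt_irrefl _ h5

/-- At `y`, `g - k` and `g + k` are bounded by `‖c - d‖` and `‖c + d‖`; by the parallelogram law
both bounds are attained. -/
theorem inner_apply_eq (hD : IsSphereIso D) (hB : IsClopen B) (he : IsUnimodularOn B e)
    {c d : ℂ} (hc : ‖c‖ = 1) (hd : ‖d‖ = 1) {g k : C(K, ℂ)} (hg : IsUnimodularOn B g)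
    (hk : IsUnimodularOn B k) (hgD : D g = c • D e) (hkD : D k = d • D e) {y : K} (hy : y ∈ B) :
    inner ℝ (g y) (k y) = (inner ℝ c d : ℝ) := by
  have hne : B.Nonempty := ⟨y, hy⟩
  have hDe := hD.norm_map e (he.norm_eq_one hne)
  refine Complex.inner_eq_of_norm_le (hg.norm_apply y hy) (hk.norm_apply y hy) hc hd ?_ ?_
  · refine ((g - k).norm_coe_le_norm y).trans ?_
    rw [← hD.norm_sub g k (hg.norm_eq_one hne) (hk.norm_eq_one hne), hgD, hkD, ← sub_smul,
      norm_smul, hDe, mul_one]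
  · refine ((g + k).norm_coe_le_norm y).trans ?_
    rw [← sub_neg_eq_add g k, ← hD.norm_sub g (-k) (hg.norm_eq_one hne) (hk.neg.norm_eq_one hne),
      hD.map_neg hB hk, hgD, hkD, sub_neg_eq_add, ← add_smul, norm_smul, hDe, mul_one]

theorem exists_clopen_map_smul (hD : IsSphereIso D) :
    ∃ K₁ : Set K, IsClopen K₁ ∧ ∀ (B : Set K) (hB : IsClopen B) (c : ℂ), ‖c‖ = 1 →
      (B ⊆ K₁ → D (c • clopenChar B hB) = c • D (clopenChar B hB)) ∧
      (B ⊆ K₁ᶜ → D (c • clopenChar B hB) = (starRingEnd ℂ c) • D (clopenChar B hB)) := by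
  obtain ⟨j, hj, hjD⟩ := hD.exists_map_eq_smul isClopen_univ
    (IsUnimodularOn.clopenChar isClopen_univ) Complex.norm_I
  have dichotomy : ∀ {B : Set K} (hB : IsClopen B) {i : C(K, ℂ)}, IsUnimodularOn B i →
      D i = Complex.I • D (clopenChar B hB) → ∀ y ∈ B, i y = Complex.I ∨ i y = -Complex.I := by
    intro B hB i hi hiD y hy
    have h1 := hD.inner_apply_eq hB (IsUnimodularOn.clopenChar hB) Complex.norm_I norm_one hi
      (IsUnimodularOn.clopenChar hB) hiD (by rw [one_smul]) hy
    rw [clopenChar_of_mem hB hy] at h1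
    simp [Complex.inner] at h1
    have h2 := hi.norm_apply y hy
    rw [← sq_eq_sq₀ (norm_nonneg _) zero_le_one, ← Complex.normSq_eq_norm_sq,
      Complex.normSq_apply, h1] at h2
    have h3 : ((i y).im - 1) * ((i y).im + 1) = 0 := by linarith
    rcases mul_eq_zero.1 h3 with h | h
    · left; apply Complex.ext <;> simp [h1]; linarith
    · right; apply Complex.ext <;> simp [h1]; linarith
  have hset : {y | j y = Complex.I}ᶜ = {y | j y = -Complex.I} := by
    ext y
    have hne : Complex.I ≠ -Complex.I := fun h => by
      have := congrArg Complex.im h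
      norm_num at this
    rcases dichotomy isClopen_univ hj hjD y trivial with h | h
    · simp [h, hne]
    · simp [h, hne.symm]
  refine ⟨{y | j y = Complex.I}, ⟨isClosed_eq (by fun_prop) continuous_const, ?_⟩, ?_⟩
  · rw [← isClosed_compl_iff, hset]
    exact isClosed_eq (by fun_prop) continuous_const
  intro B hB c hc
  have hχ := IsUnimodularOn.clopenChar hB
  obtain ⟨i, hi, hiD⟩ := hD.exists_map_eq_smul hB hχ Complex.norm_I
  -- Locality of `K₁`: the remainder of `D j`, coming from `Bᶜ`, is annihilated by support
  -- functionals at points of `B`.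
  have hij : ∀ y ∈ B, i y = j y := by
    intro y hy
    have hμ := hi.norm_apply y hy
    obtain ⟨Φ, hΦ⟩ := hD.exists_isSupport y hμ
    have hχ' := IsUnimodularOn.clopenChar hB.compl
    have hsum : clopenChar B hB + clopenChar Bᶜ hB.compl = clopenChar Set.univ isClopen_univ := by
      ext x
      by_cases hx : x ∈ B
      · simp [clopenChar, hx]
      · simp [clopenChar, hx]
    refine (hΦ.apply_eq_of_eq_one hD hμ (hj.norm_eq_one ⟨y, trivial⟩) ?_).symm
    rw [hjD, ← hsum, hD.map_add_compl hχ hχ' rfl, smul_add, _root_.map_add, ← hiD,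
      hΦ.apply_eq_one i (hi.norm_eq_one ⟨y, hy⟩) rfl, map_smul,
      hD.support_apply_eq_zero hB.compl hχ' (fun h => h hy) hμ hΦ, smul_zero, add_zero]
  have hre : ∀ {d : ℂ} {g : C(K, ℂ)}, ‖d‖ = 1 → IsUnimodularOn B g →
      D g = d • D (clopenChar B hB) → ∀ y ∈ B, (g y).re = d.re := by
    intro d g hd hg hgD y hy
    have h1 := hD.inner_apply_eq hB hχ hd norm_one hg hχ hgD (by rw [one_smul]) hy
    rw [clopenChar_of_mem hB hy] at h1
    simpa [Complex.inner] using h1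
  constructor
  · intro hsub
    obtain ⟨g, hg, hgD⟩ := hD.exists_map_eq_smul hB hχ hc
    rw [← hgD]
    congr 1
    ext y
    by_cases hy : y ∈ B
    · have h1 := hD.inner_apply_eq hB hχ hc Complex.norm_I hg hi hgD hiD hy
      rw [hij y hy, show j y = Complex.I from hsub hy] at h1
      have h2 : (g y).im = c.im := by simpa [Complex.inner] using h1
      rw [ContinuousMap.smul_apply, clopenChar_of_mem hB hy, smul_eq_mul, mul_one]
      exact (Complex.ext (hre hc hg hgD y hy) h2).symm
    · simp [hg.apply_eq_zero y hy, clopenChar_of_notMem hB hy]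
  · intro hsub
    rw [hset] at hsub
    -- Here `j = -i` reverses the sign of the imaginary part, so it is the preimage of the conjugate
    -- multiple that equals `c` on `B`.
    have hc' : ‖(starRingEnd ℂ) c‖ = 1 := by rwa [RCLike.norm_conj]
    obtain ⟨g, hg, hgD⟩ := hD.exists_map_eq_smul hB hχ hc'
    rw [← hgD]
    congr 1
    ext y
    by_cases hy : y ∈ B
    · have h1 := hD.inner_apply_eq hB hχ hc' Complex.norm_I hg hi hgD hiD hy
      rw [hij y hy, show j y = -Complex.I from hsub hy] at h1
      have h2 : (g y).im = c.im := by simpa [Complex.inner] using h1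
      rw [ContinuousMap.smul_apply, clopenChar_of_mem hB hy, smul_eq_mul, mul_one]
      exact (Complex.ext ((hre hc' hg hgD y hy).trans (Complex.conj_re c)) h2).symm
    · simp [hg.apply_eq_zero y hy, clopenChar_of_notMem hB hy]

end IsSphereIso

/-! ### Extension by zero and the theorem -/

open Classical in
theorem exists_isSphereIso_extension {E F : Type*} [NormedAddCommGroup E] [NormedAddCommGroup F]
    (Δ : Metric.sphere (0 : E) 1 → Metric.sphere (0 : F) 1)
    (hΔ : Isometry Δ) (hsurj : Function.Surjective Δ) :
    ∃ D : E → F, IsSphereIso D ∧ ∀ f : Metric.sphere (0 : E) 1, D f = Δ f := by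
  let D : E → F := fun f => if h : f ∈ Metric.sphere (0 : E) 1 then Δ ⟨f, h⟩ else 0
  have hDΔ : ∀ f : Metric.sphere (0 : E) 1, D f = Δ f := fun f => dif_pos f.2
  have hD : ∀ f (h : ‖f‖ = 1), D f = Δ ⟨f, mem_sphere_zero_iff_norm.2 h⟩ := fun f h =>
    hDΔ ⟨f, mem_sphere_zero_iff_norm.2 h⟩
  refine ⟨D, ⟨fun f hf => ?_, fun f g hf hg => ?_, fun v hv => ?_, ?_⟩, hDΔ⟩
  · rw [hD f hf]
    exact mem_sphere_zero_iff_norm.1 (Δ _).2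
  · rw [hD f hf, hD g hg, ← dist_eq_norm, ← dist_eq_norm, ← Subtype.dist_eq, hΔ.dist_eq,
      Subtype.dist_eq]
  · obtain ⟨f, hf⟩ := hsurj ⟨v, mem_sphere_zero_iff_norm.2 hv⟩
    exact ⟨f, mem_sphere_zero_iff_norm.1 f.2, by rw [hDΔ, hf]⟩
  · exact dif_neg (by simp)

theorem corollaryc {K : Type*} [TopologicalSpace K] [CompactSpace K] [T2Space K]
    [ExtremallyDisconnected K]
    {X : Type*} [NormedAddCommGroup X] [NormedSpace ℂ X] [CompleteSpace X]
    (Δ : Metric.sphere (0 : C(K, ℂ)) 1 → Metric.sphere (0 : X) 1)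
    (hΔ : Isometry Δ) (hsurj : Function.Surjective Δ) :
    ∃ K₁ : Set K, IsClopen K₁ ∧
      ∀ (B : Set K) (hB : IsClopen B) (hne : B.Nonempty) (c : ℂ) (hc : ‖c‖ = 1),
        (B ⊆ K₁ →
          (Δ (sphereChar B hB hne c hc) : X)
            = c • (Δ (sphereChar B hB hne 1 norm_one) : X)) ∧
        (B ⊆ K₁ᶜ →
          (Δ (sphereChar B hB hne c hc) : X)
            = (starRingEnd ℂ c) • (Δ (sphereChar B hB hne 1 norm_one) : X)) := by
  obtain ⟨D, hD, hDΔ⟩ := exists_isSphereIso_extension Δ hΔ hsurj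
  obtain ⟨K₁, hK₁, h⟩ := hD.exists_clopen_map_smul
  refine ⟨K₁, hK₁, fun B hB hne c hc => ?_⟩
  have h1 : D (clopenChar B hB) = Δ (sphereChar B hB hne 1 norm_one) := by
    rw [← hDΔ]; simp [sphereChar]
  rw [← h1, ← hDΔ]
  exact h B hB c hc
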